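/- Let $(K,v)$ be a henselian valued field of arbitrary rank (that is, the valuation ring of $v$ extends uniquely to every algebraic extension of $K$), let $\bar v$ be the extension of $v$ to a fixed algebraic closure $\overline K$, let $w$ be an extension of $v$ to $K(X)$, and let $\overline w$ be a fixed common extension of $w$ and $\bar v$ to $\overline K(X)$. Valuations are written additively, with values in one ordered abelian group together with $\infty$. For $0\ne f\in K[X]$ put $\delta(f)=\max\{\overline w(X-\alpha)\mid \alpha\in\overline K,\ f(\alpha)=0\}$, with $\delta(f)=-\infty$ if $f$ is constant. A nonconstant monic polynomial $Q\in K[X]$ is an abstract key polynomial (ABKP) for $w$ if $\delta(f)<\delta(Q)$ for every nonzero $f\in K[X]$ with $\deg f<\deg Q$. The $Q$-truncation of $w$ is $w_Q(f)=\min_i w(f_iQ^i)$, where $f=\sum_i f_iQ^i$ with $\deg f_i<\deg Q$. For $\theta\in\overline K$ let $\deg\theta=[K(\theta):K]$. A pair $(\theta,\alpha)$ of elements of $\overline K$ is distinguished if $\deg\theta>\deg\alpha$, $\bar v(\theta-\alpha)=\max\{\bar v(\theta-\beta)\mid\beta\in\overline K,\ \deg\beta<\deg\theta\}$, and $\bar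 v(\theta-\eta)<\bar v(\theta-\alpha)$ for every $\eta\in\overline K$ with $\deg\eta<\deg\alpha$. A pair $(g,f)$ of monic irreducible polynomials over $K$ is distinguished if some root $\theta$ of $g$ and some root $\alpha$ of $f$ form a distinguished pair $(\theta,\alpha)$. A saturated distinguished chain for $Q$ is a sequence $(Q_r=Q,Q_{r-1},\ldots,Q_0)$, $r\ge 0$, of monic irreducible polynomials over $K$ such that each $(Q_{i+1},Q_i)$ is a distinguished pair and $\deg Q_0=1$. A family $\{Q_i\}_{i\in\Delta}$ of ABKPs for $w$, indexed by an ordered set $\Delta$, is a complete set of ABKPs for $w$ if the values $\delta(Q_i)$ are pairwise distinct, the family is well-ordered by the values $\delta(Q_i)$, this ordering being the one of $\Delta$, and for every $f\in K[X]$ there is an $i\in\Delta$ with $w_{Q_i}(f)=w(f)$. Theorem. Let $Q$ be an ABKP for $w$ such that $w_Q=w$ on $K[X]$ (the extensions $w$ for which such a $Q$ exists are precisely the valuation-transcendental ones). If $(Q_r=Q,Q_{r-1},\ldots,Q_0)$ is a saturated distinguished chain for $Q$, then $\{Q_0,Q_1,\ldots,Q_r\}$, indexed by $\{0<1<\cdots<r\}$,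 is a complete set of ABKPs for $w$. Moreover $1=\deg Q_0<\deg Q_1<\cdots<\deg Q_r$, and if $w(Q_0)\ge 0$ then $w(Q_0)<w(Q_1)<\cdots<w(Q_r)$. -/

import Mathlib

open Polynomial

universe u

section KeyPolynomials

variable {K Kbar : Type u} {Γ : Type*} [Field K] [Field Kbar] [Algebra K Kbar]
  [AddCommGroup Γ] [LinearOrder Γ] [IsOrderedAddMonoid Γ]

/-- A (Krull) valuation `v : K → Γ ∪ {∞}`, of arbitrary rank, is henselian if its valuation ring
`{x | 0 ≤ v x}` has at most one prolongation to every algebraic extension `L` of `K`: any two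
valuation rings of `L` lying over it coincide. (Existence of a prolongation is automatic.) -/
def IsHenselianValuation (v : AddValuation K (WithTop Γ)) : Prop :=
  ∀ (L : Type u) [Field L] [Algebra K L] [Algebra.IsAlgebraic K L] (A B : ValuationSubring L),
    (∀ x : K, algebraMap K L x ∈ A ↔ 0 ≤ v x) →
    (∀ x : K, algebraMap K L x ∈ B ↔ 0 ≤ v x) → A = B

/-- `w` is an extension of the valuation `v` of `K` to the rational function field `K(X)`. -/
def IsExtensionToRatFunc (v : AddValuation K (WithTop Γ))
    (w : AddValuation (RatFunc K) (WithTop Γ)) : Prop :=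
  ∀ a : K, w (RatFunc.C a) = v a

/-- `wbar` is a common extension to `Kbar(X)` of the valuation `w` of `K(X)` and of the valuation
`vbar` of `Kbar`. (As `K(X)` is the fraction field of `K[X]`, it is enough to compare `wbar` and
`w` on polynomials.) -/
structure IsCommonExtension (vbar : AddValuation Kbar (WithTop Γ))
    (w : AddValuation (RatFunc K) (WithTop Γ))
    (wbar : AddValuation (RatFunc Kbar) (WithTop Γ)) : Prop where
  extends_vbar : ∀ a : Kbar, wbar (RatFunc.C a) = vbar a
  extends_w : ∀ f : K[X], wbar (algebraMap Kbar[X] (RatFunc Kbar) (f.map (algebraMap K Kbar))) =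
    w (algebraMap K[X] (RatFunc K) f)

/-- The degree of `α` over `K`, i.e. the degree of the extension `K(α)/K`. -/
noncomputable def degOver (K : Type u) {Kbar : Type u} [Field K] [Field Kbar] [Algebra K Kbar]
    (α : Kbar) : ℕ :=
  Module.finrank K (IntermediateField.adjoin K {α})

/-- The optimal value `δ(f) = max {wbar (X - α) | α a root of f in Kbar}` of a nonzero polynomial
`f`; by convention it is `⊥` (that is, `-∞`) if `f` has no root. -/
noncomputable def optimalValue (wbar : AddValuation (RatFunc Kbar) (WithTop Γ)) (f : K[X]) :
    WithBot (WithTop Γ) :=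
  ((f.aroots Kbar).map fun α =>
    ((wbar (RatFunc.X - RatFunc.C α) : WithTop Γ) : WithBot (WithTop Γ))).sup

/-- Abstract key polynomials for the restriction of `wbar` to `K(X)`: (nonconstant) monic
polynomials `Q` over `K` such that `δ(f) < δ(Q)` for all `f` of smaller degree. -/
structure IsABKP (wbar : AddValuation (RatFunc Kbar) (WithTop Γ)) (Q : K[X]) : Prop where
  monic : Q.Monic
  natDegree_pos : 0 < Q.natDegree
  lt_optimalValue : ∀ f : K[X], f ≠ 0 → f.natDegree < Q.natDegree →
    optimalValue wbar f < optimalValue wbar Q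

/-- The coefficient `f_i` in the `Q`-expansion `f = ∑ f_i Q ^ i`, `deg f_i < deg Q`: divide `f`
by `Q` with remainder `i` times, then take the remainder modulo `Q`. -/
noncomputable def expansionCoeff (Q f : K[X]) (i : ℕ) : K[X] :=
  ((fun g : K[X] => g /ₘ Q)^[i] f) %ₘ Q

theorem degree_expansionCoeff_lt {Q : K[X]} (hQ : Q.Monic) (f : K[X]) (i : ℕ) :
    (expansionCoeff Q f i).degree < Q.degree :=
  degree_modByMonic_lt _ hQ

theorem sum_expansionCoeff {Q : K[X]} (hQ : Q.Monic) (hd : 0 < Q.natDegree) (n : ℕ) :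
    ∀ f : K[X], f.natDegree < n →
      ∑ i ∈ Finset.range n, expansionCoeff Q f i * Q ^ i = f := by
  induction n with
  | zero => intro f hf; omega
  | succ n ih =>
    intro f hf
    rw [Finset.sum_range_succ']
    have key : ∑ i ∈ Finset.range n, expansionCoeff Q f (i + 1) * Q ^ (i + 1) =
        Q * (f /ₘ Q) := by
      have hstep : ∀ i, expansionCoeff Q f (i + 1) * Q ^ (i + 1) =
          Q * (expansionCoeff Q (f /ₘ Q) i * Q ^ i) := by
        intro i
        simp only [expansionCoeff, Function.iterate_succ_apply]
        ring
      simp only [hstep, ← Finset.mul_sum]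
      congr 1
      rcases Nat.eq_zero_or_pos n with hn | hn
      · subst hn
        have h0 : f /ₘ Q = 0 := by
          rw [divByMonic_eq_zero_iff hQ]
          exact degree_lt_degree (by omega)
        simp [h0]
      · apply ih
        rw [natDegree_divByMonic f hQ]
        omega
    rw [key]
    have := modByMonic_add_div f Q
    simp only [expansionCoeff, Function.iterate_zero, id_eq, pow_zero, mul_one]
    rw [add_comm]
    exact this

/-- The `Q`-truncation `w_Q(f) = min_i w(f_i Q ^ i)` of `w`, where `f = ∑ f_i Q ^ i` is the
`Q`-expansion of the polynomial `f`. -/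
noncomputable def truncation (w : AddValuation (RatFunc K) (WithTop Γ)) (Q f : K[X]) : WithTop Γ :=
  (Finset.range (f.natDegree + 1)).inf fun i =>
    w (algebraMap K[X] (RatFunc K) (expansionCoeff Q f i * Q ^ i))

/-- `(θ, α)` is a `(K, v)`-distinguished pair of elements of `Kbar`. -/
structure IsDistinguishedPair (K : Type u) {Kbar : Type u} {Γ : Type*} [Field K] [Field Kbar]
    [Algebra K Kbar] [AddCommGroup Γ] [LinearOrder Γ] [IsOrderedAddMonoid Γ]
    (vbar : AddValuation Kbar (WithTop Γ)) (θ α : Kbar) : Prop where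
  deg_lt : degOver K α < degOver K θ
  isGreatest : IsGreatest {γ | ∃ β : Kbar, degOver K β < degOver K θ ∧ γ = vbar (θ - β)}
    (vbar (θ - α))
  lt_of_deg_lt : ∀ η : Kbar, degOver K η < degOver K α → vbar (θ - η) < vbar (θ - α)

/-- `(g, f)` is a distinguished pair of (monic irreducible) polynomials over `K`. -/
def IsDistinguishedPolyPair (vbar : AddValuation Kbar (WithTop Γ)) (g f : K[X]) : Prop :=
  ∃ θ α : Kbar, aeval θ g = 0 ∧ aeval α f = 0 ∧ IsDistinguishedPair K vbar θ α

/-- `(F r, F (r - 1), …, F 0)` is a saturated distinguished chain for `Q` of length `r`: the `F i`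
are monic irreducible polynomials over `K`, `F r = Q`, each `(F (i + 1), F i)` is a distinguished
pair, and the roots of `F 0` lie in `K`, i.e. `F 0` is linear. -/
structure IsSaturatedDistinguishedChain (vbar : AddValuation Kbar (WithTop Γ)) (Q : K[X])
    {r : ℕ} (F : Fin (r + 1) → K[X]) : Prop where
  last_eq : F (Fin.last r) = Q
  monic : ∀ i, (F i).Monic
  irreducible : ∀ i, Irreducible (F i)
  pair : ∀ i : Fin r, IsDistinguishedPolyPair vbar (F i.succ) (F i.castSucc)
  natDegree_zero : (F 0).natDegree = 1

/-- The family `(Λ i)`, indexed by an ordered set `ι`, is a complete set of abstract key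
polynomials for `w` (with respect to the common extension `wbar`). -/
structure IsCompleteSet (w : AddValuation (RatFunc K) (WithTop Γ))
    (wbar : AddValuation (RatFunc Kbar) (WithTop Γ)) {ι : Type*} [LinearOrder ι]
    (Λ : ι → K[X]) : Prop where
  abkp : ∀ i, IsABKP wbar (Λ i)
  optimalValue_ne : ∀ i j, i ≠ j → optimalValue wbar (Λ i) ≠ optimalValue wbar (Λ j)
  wellOrder : IsWellOrder ι fun i j => optimalValue wbar (Λ i) < optimalValue wbar (Λ j)
  lt_iff : ∀ i j, i < j ↔ optimalValue wbar (Λ i) < optimalValue wbar (Λ j)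
  exists_truncation_eq : ∀ f : K[X], ∃ i,
    truncation w (Λ i) f = w (algebraMap K[X] (RatFunc K) f)

end KeyPolynomials

/-! Henselianity makes `vbar` invariant under `K`-automorphisms of `Kbar`, so a distinguished pair
below an ABKP `g` may be conjugated until its first member `θ` is a root attaining `δ(g)`. Every `β`
of smaller degree then satisfies `wbar (X - β) < wbar (X - θ)`, hence `wbar (X - β) = vbar (θ - β)`:
below `deg θ`, `wbar` is read off from distances to `θ`.

The last condition on a distinguished pair thus becomes the ABKP condition for `f`
(`IsABKP.of_isDistinguishedPolyPair`), and the property descends the chain from `Q`. Degrees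
strictly increase, so the optimal values do too, and the top member `Q` alone supplies all the
truncations.

For the values, `w(f) = vbar (f(θ)) ≤ vbar (g(α)) < w(g)` (`IsABKP.map_lt_map`): the first
inequality comes from the symmetry `deg g · v(f(θ)) = deg f · v(g(α))`, the second from comparing
factors root by root. -/

theorem Multiset.sup_mem_of_ne_zero {α : Type*} [LinearOrder α] [OrderBot α] {s : Multiset α}
    (hs : s ≠ 0) : s.sup ∈ s := by
  induction s using Multiset.induction_on with
  | empty => exact absurd rfl hs
  | cons a s ih =>
    rw [Multiset.sup_cons]
    rcases eq_or_ne s 0 with rfl | h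
    · simp
    · rcases le_total a s.sup with hle | hle
      · rw [sup_eq_right.2 hle]
        exact Multiset.mem_cons_of_mem (ih h)
      · rw [sup_eq_left.2 hle]
        exact Multiset.mem_cons_self a s

namespace WithTop

variable {Γ : Type*} [AddCommGroup Γ] [LinearOrder Γ] [IsOrderedAddMonoid Γ]

theorem le_of_nsmul_eq_nsmul {a b : WithTop Γ} {m n : ℕ} (hm : 0 < m) (hmn : m ≤ n) (ha : 0 ≤ a)
    (hat : a ≠ ⊤) (h : n • a = m • b) : a ≤ b := by
  by_contra! hlt
  lift a to Γ using hat
  lift b to Γ using (hlt.trans_le le_top).ne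
  norm_cast at ha h hlt
  exact absurd h ((nsmul_lt_nsmul_right hm.ne' hlt).trans_le (nsmul_le_nsmul_left ha hmn)).ne'

theorem sum_map_lt_sum_map {ι : Type*} {s : Multiset ι} {f g : ι → WithTop Γ}
    (hle : ∀ i ∈ s, f i ≤ g i) (htop : ∀ i ∈ s, f i ≠ ⊤) (hlt : ∃ i ∈ s, f i < g i) :
    (s.map f).sum < (s.map g).sum := by
  obtain ⟨i, hi, hfg⟩ := hlt
  obtain ⟨t, rfl⟩ := Multiset.exists_cons_of_mem hi
  simp only [Multiset.map_cons, Multiset.sum_cons]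
  refine WithTop.add_lt_add_of_lt_of_le ?_ hfg
    (Multiset.sum_map_le_sum_map _ _ fun j hj => hle j (Multiset.mem_cons_of_mem hj))
  have : ∀ j ∈ t, f j ≠ ⊤ := fun j hj => htop j (Multiset.mem_cons_of_mem hj)
  clear hle htop hi
  induction t using Multiset.induction_on with
  | empty => simp
  | cons a t ih =>
    simp only [Multiset.map_cons, Multiset.sum_cons]
    exact WithTop.add_ne_top.2 ⟨this a (Multiset.mem_cons_self a t),
      ih fun j hj => this j (Multiset.mem_cons_of_mem hj)⟩

end WithTop

/-! ### Galois invariance of a henselian valuation. -/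

section KeyPolynomialChains

variable {K Kbar : Type u} {Γ : Type*} [Field K] [Field Kbar] [Algebra K Kbar]
  [AddCommGroup Γ] [LinearOrder Γ] [IsOrderedAddMonoid Γ]

/-- The valuation ring of an additive valuation. -/
def AddValuation.integerSubring {L : Type*} [Field L] (μ : AddValuation L (WithTop Γ)) :
    ValuationSubring L where
  carrier := {x | 0 ≤ μ x}
  mul_mem' {x y} hx hy := by
    simp only [Set.mem_ofPred_eq, AddValuation.map_mul] at *
    exact add_nonneg hx hy
  one_mem' := by simp
  add_mem' hx hy := μ.map_le_add hx hy
  zero_mem' := by simp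
  neg_mem' {x} hx := by simpa [AddValuation.map_neg] using hx
  mem_or_inv_mem' x := by
    rcases eq_or_ne x 0 with rfl | hx
    · simp
    by_contra! h
    simp only [Set.mem_ofPred_eq, not_le] at h
    have h1 : μ x + μ x⁻¹ = 0 := by rw [← μ.map_mul, mul_inv_cancel₀ hx, μ.map_one]
    exact absurd h1 ((add_le_of_nonpos_right h.2.le).trans_lt h.1).ne

theorem AddValuation.mem_integerSubring {L : Type*} [Field L] {μ : AddValuation L (WithTop Γ)}
    {x : L} : x ∈ μ.integerSubring ↔ 0 ≤ μ x := Iff.rfl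

theorem AddValuation.map_multiset_prod {R ι : Type*} [CommRing R]
    (μ : AddValuation R (WithTop Γ)) (s : Multiset ι) (f : ι → R) :
    μ (s.map f).prod = (s.map fun i => μ (f i)).sum := by
  induction s using Multiset.induction_on with
  | empty => simp
  | cons a s ih => simp [AddValuation.map_mul, ih]

/-- A valuation ring determines the order of values, since `μ x ≤ μ y` means that `y / x` lies in
the ring. -/
theorem AddValuation.le_of_forall_nonneg_iff {L : Type*} [Field L]
    {μ ν : AddValuation L (WithTop Γ)} (h : ∀ x, 0 ≤ μ x ↔ 0 ≤ ν x) {x y : L} (hxy : μ x ≤ μ y) :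
    ν x ≤ ν y := by
  rcases eq_or_ne x 0 with rfl | hx
  · have : y = 0 := by simpa using hxy
    simp [this]
  have key : ∀ ρ : AddValuation L (WithTop Γ), ρ x ≤ ρ y ↔ 0 ≤ ρ (y / x) := by
    intro ρ
    have hy : ρ y = ρ x + ρ (y / x) := by rw [← ρ.map_mul, mul_div_cancel₀ y hx]
    have hxt : ρ x ≠ ⊤ := ρ.ne_top_iff.2 hx
    have h0 := WithTop.add_le_add_iff_left (y := 0) (z := ρ (y / x)) hxt
    rwa [add_zero, ← hy] at h0
  exact (key ν).2 ((h _).1 ((key μ).1 hxy))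

/-- Uniqueness of the valuation ring only says that automorphisms preserve the order of values.
Equality of values follows because the orbit of `x` is finite, so a monotone sequence of values
along it returns to its start. -/
theorem IsHenselianValuation.map_algEquiv [Algebra.IsAlgebraic K Kbar]
    {v : AddValuation K (WithTop Γ)} (hv : IsHenselianValuation v)
    {vbar : AddValuation Kbar (WithTop Γ)} (hvbar : ∀ a : K, vbar (algebraMap K Kbar a) = v a)
    (σ : Kbar ≃ₐ[K] Kbar) (x : Kbar) : vbar (σ x) = vbar x := by
  have hle : ∀ τ : Kbar ≃ₐ[K] Kbar, ∀ y z, vbar y ≤ vbar z → vbar (τ y) ≤ vbar (τ z) := by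
    intro τ
    let ν : AddValuation Kbar (WithTop Γ) := vbar.comap (τ : Kbar →+* Kbar)
    have hν : ∀ y, ν y = vbar (τ y) := fun y => rfl
    have h := hv Kbar vbar.integerSubring ν.integerSubring
      (fun a => by rw [AddValuation.mem_integerSubring, hvbar])
      (fun a => by rw [AddValuation.mem_integerSubring, hν, AlgEquiv.commutes, hvbar])
    intro y z hyz
    exact AddValuation.le_of_forall_nonneg_iff (μ := vbar) (ν := ν)
      (fun y => by rw [← AddValuation.mem_integerSubring, h, AddValuation.mem_integerSubring]) hyz
  have mono : ∀ τ : Kbar ≃ₐ[K] Kbar, vbar x ≤ vbar (τ x) → vbar (τ x) = vbar x := by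
    intro τ hτ
    have hchain : Monotone fun n : ℕ => vbar ((τ ^ n) x) := by
      refine monotone_nat_of_le_succ fun n => ?_
      rw [pow_succ, AlgEquiv.mul_apply]
      exact hle _ _ _ hτ
    have hfin : (Set.range fun n : ℕ => (τ ^ n) x).Finite := by
      refine ((minpoly K x).rootSet_finite Kbar).subset ?_
      rintro _ ⟨n, rfl⟩
      rw [mem_rootSet_of_ne (minpoly.ne_zero (Algebra.IsIntegral.isIntegral x))]
      rw [← minpoly.algEquiv_eq (τ ^ n) x]
      exact minpoly.aeval _ _
    obtain ⟨m, n, hmn, heq⟩ : ∃ m n : ℕ, m < n ∧ (τ ^ m) x = (τ ^ n) x := by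
      by_contra! hne
      refine Set.infinite_range_of_injective (f := fun n : ℕ => (τ ^ n) x) ?_ hfin
      intro m n h
      rcases lt_trichotomy m n with h' | h' | h'
      · exact absurd h (hne _ _ h')
      · exact h'
      · exact absurd h.symm (hne _ _ h')
    have h0 : (τ ^ (n - m)) x = x := by
      apply (τ ^ m).injective
      rw [← AlgEquiv.mul_apply, ← pow_add, heq]
      congr 2
      omega
    have h1 := hchain (show 1 ≤ n - m by omega)
    simp only [pow_one, h0] at h1
    exact le_antisymm h1 hτ
  rcases le_total (vbar x) (vbar (σ x)) with h | h
  · exact mono σ h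
  -- The opposite inequality for `σ` is the favourable one for `σ⁻¹`.
  · have h2 := hle σ⁻¹ _ _ h
    have h3 : σ⁻¹ (σ x) = x := σ.symm_apply_apply x
    rw [h3] at h2
    have h4 := mono σ⁻¹ h2
    have h5 := hle σ (σ⁻¹ x) x h4.le
    have h6 : σ (σ⁻¹ x) = x := σ.apply_symm_apply x
    rw [h6] at h5
    exact le_antisymm h h5

/-! ### Degrees, conjugates and sums over roots. -/

theorem degOver_eq_natDegree_minpoly [Algebra.IsAlgebraic K Kbar] (α : Kbar) :
    degOver K α = (minpoly K α).natDegree :=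
  IntermediateField.adjoin.finrank (Algebra.IsIntegral.isIntegral α)

theorem degOver_algEquiv [Algebra.IsAlgebraic K Kbar] (σ : Kbar ≃ₐ[K] Kbar) (α : Kbar) :
    degOver K (σ α) = degOver K α := by
  rw [degOver_eq_natDegree_minpoly, degOver_eq_natDegree_minpoly, minpoly.algEquiv_eq]

theorem degOver_of_irreducible [Algebra.IsAlgebraic K Kbar] {f : K[X]} (hf : Irreducible f)
    (hm : f.Monic) {α : Kbar} (hα : aeval α f = 0) : degOver K α = f.natDegree := by
  rw [degOver_eq_natDegree_minpoly, ← minpoly.eq_of_irreducible_of_monic hf hα hm]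

theorem degOver_le_natDegree [Algebra.IsAlgebraic K Kbar] {f : K[X]} (hf : f ≠ 0) {α : Kbar}
    (hα : aeval α f = 0) : degOver K α ≤ f.natDegree := by
  rw [degOver_eq_natDegree_minpoly]
  exact natDegree_le_of_dvd (minpoly.dvd K α hα) hf

theorem exists_algEquiv_of_aeval_eq_zero [Normal K Kbar] {f : K[X]} (hf : Irreducible f)
    (hm : f.Monic) {α β : Kbar} (hα : aeval α f = 0) (hβ : aeval β f = 0) :
    ∃ σ : Kbar ≃ₐ[K] Kbar, σ α = β :=
  isConjRoot_iff_exists_algEquiv.1 (by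
    rw [IsConjRoot, ← minpoly.eq_of_irreducible_of_monic hf hα hm,
      ← minpoly.eq_of_irreducible_of_monic hf hβ hm])

/-- The homomorphism `φ` is left free to cover both evaluation at a point of `Kbar` and the
inclusion into `Kbar(X)`. -/
theorem AddValuation.map_aroots [IsAlgClosed Kbar] {L : Type*} [CommRing L]
    (μ : AddValuation L (WithTop Γ)) (φ : Kbar[X] →+* L) {f : K[X]} (hf : f.Monic) :
    μ (φ (f.map (algebraMap K Kbar))) =
      ((f.aroots Kbar).map fun α => μ (φ (X - C α))).sum := by
  rw [(IsAlgClosed.splits (f.map (algebraMap K Kbar))).eq_prod_roots_of_monic (hf.map _),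
    _root_.map_multiset_prod, Multiset.map_map, AddValuation.map_multiset_prod]
  rfl

theorem AddValuation.map_aeval_eq_sum [IsAlgClosed Kbar] (μ : AddValuation Kbar (WithTop Γ))
    (θ : Kbar) {f : K[X]} (hf : f.Monic) :
    μ (aeval θ f) = ((f.aroots Kbar).map fun α => μ (θ - α)).sum := by
  have h := μ.map_aroots (evalRingHom θ) hf
  simpa [eval_map_algebraMap] using h

/-- The symmetry `deg g · v(f(θ)) = deg f · v(g(α))` for irreducible `g`, `f` with roots
`θ`, `α`. -/
theorem natDegree_nsmul_map_aeval [IsAlgClosed Kbar] [Normal K Kbar]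
    {μ : AddValuation Kbar (WithTop Γ)} (hμ : ∀ (σ : Kbar ≃ₐ[K] Kbar) x, μ (σ x) = μ x)
    {f g : K[X]} (hf : Irreducible f) (hfm : f.Monic) (hg : Irreducible g) (hgm : g.Monic)
    {α θ : Kbar} (hα : aeval α f = 0) (hθ : aeval θ g = 0) :
    g.natDegree • μ (aeval θ f) = f.natDegree • μ (aeval α g) := by
  have hconst : ∀ {p q : K[X]}, Irreducible p → p.Monic → ∀ {β : Kbar}, aeval β p = 0 →
      ((p.aroots Kbar).map fun β' => μ (aeval β' q)).sum = p.natDegree • μ (aeval β q) := by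
    intro p q hp hpm β hβ
    rw [Multiset.map_congr rfl (g := fun _ => μ (aeval β q)), Multiset.map_const',
      Multiset.sum_replicate, IsAlgClosed.card_aroots_eq_natDegree]
    intro β' hβ'
    obtain ⟨σ, rfl⟩ := exists_algEquiv_of_aeval_eq_zero hp hpm hβ (mem_aroots.1 hβ').2
    rw [show aeval (σ β) q = σ (aeval β q) from aeval_algHom_apply σ β q, hμ]
  -- Conjugate roots contribute equally, so both sides are the double sum of `μ (θ' - α')` over
  -- roots `θ'` of `g` and `α'` of `f`.
  rw [← hconst hg hgm hθ, ← hconst hf hfm hα]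
  simp only [μ.map_aeval_eq_sum _ hfm, μ.map_aeval_eq_sum _ hgm]
  rw [Multiset.sum_map_sum_map]
  simp only [μ.map_sub_swap]

theorem IsDistinguishedPair.map_algEquiv [Algebra.IsAlgebraic K Kbar]
    {vbar : AddValuation Kbar (WithTop Γ)}
    (hinv : ∀ (σ : Kbar ≃ₐ[K] Kbar) x, vbar (σ x) = vbar x) {θ α : Kbar}
    (h : IsDistinguishedPair K vbar θ α) (σ : Kbar ≃ₐ[K] Kbar) :
    IsDistinguishedPair K vbar (σ θ) (σ α) := by
  have hsub : ∀ β, vbar (σ θ - β) = vbar (θ - σ.symm β) := by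
    intro β
    rw [← hinv σ (θ - σ.symm β), map_sub σ, σ.apply_symm_apply]
  refine ⟨?_, ⟨⟨σ α, ?_, rfl⟩, ?_⟩, ?_⟩
  · rw [degOver_algEquiv, degOver_algEquiv]
    exact h.deg_lt
  · rw [degOver_algEquiv, degOver_algEquiv]
    exact h.deg_lt
  · rintro _ ⟨β, hβ, rfl⟩
    rw [hsub, hsub, σ.symm_apply_apply]
    refine h.isGreatest.2 ⟨σ.symm β, ?_, rfl⟩
    rwa [degOver_algEquiv, ← degOver_algEquiv σ θ]
  · intro η hη
    rw [hsub, hsub, σ.symm_apply_apply]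
    refine h.lt_of_deg_lt _ ?_
    rwa [degOver_algEquiv, ← degOver_algEquiv σ α]

/-! ### Optimal values and descent of the ABKP property. -/

theorem le_optimalValue (wbar : AddValuation (RatFunc Kbar) (WithTop Γ)) {f : K[X]} (hf : f ≠ 0)
    {α : Kbar} (hα : aeval α f = 0) :
    ((wbar (RatFunc.X - RatFunc.C α) : WithTop Γ) : WithBot (WithTop Γ)) ≤
      optimalValue wbar f :=
  Multiset.le_sup (Multiset.mem_map_of_mem _ (mem_aroots.2 ⟨hf, hα⟩))

theorem exists_eq_optimalValue [IsAlgClosed Kbar]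
    (wbar : AddValuation (RatFunc Kbar) (WithTop Γ)) {f : K[X]} (hf : 0 < f.natDegree) :
    ∃ α : Kbar, aeval α f = 0 ∧
      optimalValue wbar f = (wbar (RatFunc.X - RatFunc.C α) : WithTop Γ) := by
  have hne : (f.aroots Kbar).map (fun α =>
      ((wbar (RatFunc.X - RatFunc.C α) : WithTop Γ) : WithBot (WithTop Γ))) ≠ 0 := by
    rw [ne_eq, Multiset.map_eq_zero, ← Multiset.card_eq_zero,
      IsAlgClosed.card_aroots_eq_natDegree]
    exact hf.ne'
  obtain ⟨α, hα, h⟩ := Multiset.mem_map.1 (Multiset.sup_mem_of_ne_zero hne)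
  exact ⟨α, (mem_aroots.1 hα).2, h.symm⟩

theorem optimalValue_lt [IsAlgClosed Kbar] (wbar : AddValuation (RatFunc Kbar) (WithTop Γ))
    {f : K[X]} {γ : WithTop Γ}
    (h : ∀ α : Kbar, aeval α f = 0 → wbar (RatFunc.X - RatFunc.C α) < γ) :
    optimalValue wbar f < γ := by
  rcases Nat.eq_zero_or_pos f.natDegree with h0 | h0
  · have : f.aroots Kbar = 0 := by
      rw [← Multiset.card_eq_zero, IsAlgClosed.card_aroots_eq_natDegree, h0]
    rw [optimalValue, this, Multiset.map_zero, Multiset.sup_zero]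
    exact WithBot.bot_lt_coe γ
  · obtain ⟨α, hα, heq⟩ := exists_eq_optimalValue wbar h0
    rw [heq]
    exact WithBot.coe_lt_coe.2 (h α hα)

/-- In `θ - β = (X - β) - (X - θ)` the first term has strictly smaller value and decides. -/
theorem AddValuation.map_X_sub_C_of_lt {vbar : AddValuation Kbar (WithTop Γ)}
    {wbar : AddValuation (RatFunc Kbar) (WithTop Γ)} (hext : ∀ a, wbar (RatFunc.C a) = vbar a)
    {θ β : Kbar} (h : wbar (RatFunc.X - RatFunc.C β) < wbar (RatFunc.X - RatFunc.C θ)) :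
    wbar (RatFunc.X - RatFunc.C β) = vbar (θ - β) := by
  rw [← hext, ← wbar.map_sub_eq_of_lt_left h]
  congr 1
  rw [_root_.map_sub]
  ring

/-- A distinguished pair below an abstract key polynomial can be chosen to have its first member
at a root where the optimal value is attained. -/
theorem IsABKP.exists_isDistinguishedPair [IsAlgClosed Kbar] [Normal K Kbar]
    {vbar : AddValuation Kbar (WithTop Γ)} {wbar : AddValuation (RatFunc Kbar) (WithTop Γ)}
    (hinv : ∀ (σ : Kbar ≃ₐ[K] Kbar) x, vbar (σ x) = vbar x)
    {g f : K[X]} (hg : IsABKP wbar g) (hgi : Irreducible g)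
    (hpair : IsDistinguishedPolyPair vbar g f) :
    ∃ θ α : Kbar, aeval θ g = 0 ∧ aeval α f = 0 ∧ IsDistinguishedPair K vbar θ α ∧
      optimalValue wbar g = (wbar (RatFunc.X - RatFunc.C θ) : WithTop Γ) := by
  obtain ⟨θ, hθ, heq⟩ := exists_eq_optimalValue (Kbar := Kbar) wbar hg.natDegree_pos
  obtain ⟨θ₀, α₀, hθ₀, hα₀, hd⟩ := hpair
  obtain ⟨σ, rfl⟩ := exists_algEquiv_of_aeval_eq_zero hgi hg.monic hθ₀ hθ
  refine ⟨σ θ₀, σ α₀, hθ, ?_, hd.map_algEquiv hinv σ, heq⟩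
  rw [show aeval (σ α₀) f = σ (aeval α₀ f) from aeval_algHom_apply σ α₀ f, hα₀, map_zero]

/-- The ABKP condition is tested on the minimal polynomial of `β`. -/
theorem IsABKP.map_X_sub_C_lt [IsAlgClosed Kbar] [Algebra.IsAlgebraic K Kbar]
    {wbar : AddValuation (RatFunc Kbar) (WithTop Γ)} {g : K[X]} (hg : IsABKP wbar g)
    (hgi : Irreducible g) {θ : Kbar} (hθ : aeval θ g = 0)
    (heq : optimalValue wbar g = (wbar (RatFunc.X - RatFunc.C θ) : WithTop Γ)) {β : Kbar}
    (hβ : degOver K β < degOver K θ) :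
    wbar (RatFunc.X - RatFunc.C β) < wbar (RatFunc.X - RatFunc.C θ) := by
  have hne := minpoly.ne_zero (Algebra.IsIntegral.isIntegral (R := K) β)
  rw [degOver_of_irreducible hgi hg.monic hθ, degOver_eq_natDegree_minpoly] at hβ
  have h := (le_optimalValue wbar hne (minpoly.aeval K β)).trans_lt (hg.lt_optimalValue _ hne hβ)
  rw [heq] at h
  exact WithBot.coe_lt_coe.1 h

/-- Both `α` and any `β` of smaller degree lie below `deg θ`, so their values against `X` are
distances to `θ`, which the distinguished pair compares. -/
theorem IsABKP.of_isDistinguishedPolyPair [IsAlgClosed Kbar] [Normal K Kbar]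
    {vbar : AddValuation Kbar (WithTop Γ)} {wbar : AddValuation (RatFunc Kbar) (WithTop Γ)}
    (hinv : ∀ (σ : Kbar ≃ₐ[K] Kbar) x, vbar (σ x) = vbar x)
    (hext : ∀ a, wbar (RatFunc.C a) = vbar a)
    {g f : K[X]} (hg : IsABKP wbar g) (hgi : Irreducible g) (hfi : Irreducible f) (hfm : f.Monic)
    (hpair : IsDistinguishedPolyPair vbar g f) : IsABKP wbar f := by
  obtain ⟨θ, α, hθ, hα, hd, heq⟩ := hg.exists_isDistinguishedPair hinv hgi hpair
  refine ⟨hfm, hfi.natDegree_pos, fun p hp hpdeg => ?_⟩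
  refine (optimalValue_lt wbar fun β hβ => ?_).trans_le (le_optimalValue wbar hfm.ne_zero hα)
  have hβα : degOver K β < degOver K α := by
    rw [degOver_of_irreducible hfi hfm hα]
    exact (degOver_le_natDegree hp hβ).trans_lt hpdeg
  rw [AddValuation.map_X_sub_C_of_lt hext (hg.map_X_sub_C_lt hgi hθ heq hd.deg_lt),
    AddValuation.map_X_sub_C_of_lt hext (hg.map_X_sub_C_lt hgi hθ heq (hβα.trans hd.deg_lt))]
  exact hd.lt_of_deg_lt β hβα

theorem IsDistinguishedPolyPair.natDegree_lt [Algebra.IsAlgebraic K Kbar]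
    {vbar : AddValuation Kbar (WithTop Γ)} {g f : K[X]}
    (hgi : Irreducible g) (hgm : g.Monic) (hfi : Irreducible f) (hfm : f.Monic)
    (hpair : IsDistinguishedPolyPair vbar g f) : f.natDegree < g.natDegree := by
  obtain ⟨θ, α, hθ, hα, hd⟩ := hpair
  rw [← degOver_of_irreducible hgi hgm hθ, ← degOver_of_irreducible hfi hfm hα]
  exact hd.deg_lt

theorem IsABKP.map_lt_map [IsAlgClosed Kbar] [Normal K Kbar]
    {vbar : AddValuation Kbar (WithTop Γ)} {w : AddValuation (RatFunc K) (WithTop Γ)}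
    {wbar : AddValuation (RatFunc Kbar) (WithTop Γ)}
    (hinv : ∀ (σ : Kbar ≃ₐ[K] Kbar) x, vbar (σ x) = vbar x)
    (hwbar : IsCommonExtension vbar w wbar)
    {g f : K[X]} (hg : IsABKP wbar g) (hgi : Irreducible g) (hfi : Irreducible f) (hfm : f.Monic)
    (hpair : IsDistinguishedPolyPair vbar g f)
    (h0 : 0 ≤ w (algebraMap K[X] (RatFunc K) f)) :
    w (algebraMap K[X] (RatFunc K) f) < w (algebraMap K[X] (RatFunc K) g) := by
  have hdeg := hpair.natDegree_lt hgi hg.monic hfi hfm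
  obtain ⟨θ, α, hθ, hα, hd, heq⟩ := hg.exists_isDistinguishedPair hinv hgi hpair
  have hext := hwbar.extends_vbar
  have hsmall : ∀ β : Kbar, degOver K β < degOver K θ →
      wbar (RatFunc.X - RatFunc.C β) = vbar (θ - β) := fun β hβ =>
    AddValuation.map_X_sub_C_of_lt hext (hg.map_X_sub_C_lt hgi hθ heq hβ)
  have hsum : ∀ p : K[X], p.Monic → w (algebraMap K[X] (RatFunc K) p) =
      ((p.aroots Kbar).map fun β => wbar (RatFunc.X - RatFunc.C β)).sum := by
    intro p hp
    rw [← hwbar.extends_w, wbar.map_aroots (algebraMap Kbar[X] (RatFunc Kbar)) hp]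
    simp
  have hwf : w (algebraMap K[X] (RatFunc K) f) = vbar (aeval θ f) := by
    rw [hsum f hfm, vbar.map_aeval_eq_sum θ hfm]
    refine congrArg _ (Multiset.map_congr rfl fun β hβ => hsmall β ?_)
    rw [degOver_of_irreducible hfi hfm (mem_aroots.1 hβ).2, ← degOver_of_irreducible hfi hfm hα]
    exact hd.deg_lt
  have hαθ : vbar (θ - α) < wbar (RatFunc.X - RatFunc.C θ) := by
    rw [← hsmall α hd.deg_lt]
    exact hg.map_X_sub_C_lt hgi hθ heq hd.deg_lt
  -- Conjugating `θ'` back to `θ` replaces `α` by a conjugate of the same degree, and `α` is already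
  -- closest to `θ` in degrees below `deg θ`.
  have hle : ∀ θ' ∈ g.aroots Kbar, vbar (α - θ') ≤ vbar (θ - α) := by
    intro θ' hθ'
    obtain ⟨σ, rfl⟩ := exists_algEquiv_of_aeval_eq_zero hgi hg.monic hθ (mem_aroots.1 hθ').2
    rw [vbar.map_sub_swap, ← σ.apply_symm_apply α, ← map_sub, hinv, σ.apply_symm_apply]
    exact hd.isGreatest.2 ⟨σ.symm α, by rw [degOver_algEquiv]; exact hd.deg_lt, rfl⟩
  have hlt : vbar (aeval α g) < w (algebraMap K[X] (RatFunc K) g) := by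
    rw [hsum g hg.monic, vbar.map_aeval_eq_sum α hg.monic]
    refine WithTop.sum_map_lt_sum_map (fun θ' hθ' => ?_)
      (fun θ' hθ' => (((hle θ' hθ').trans_lt hαθ).trans_le le_top).ne)
      ⟨θ, mem_aroots.2 ⟨hg.monic.ne_zero, hθ⟩, by rwa [vbar.map_sub_swap]⟩
    -- The ultrametric inequality is applied to `θ - θ' = (θ - α) + (α - θ')`, then to `X - θ' = (X
    -- - θ) + (θ - θ')`.
    have h1 : vbar (α - θ') ≤ wbar (RatFunc.X - RatFunc.C θ) := (hle θ' hθ').trans hαθ.le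
    have h2 : vbar (α - θ') ≤ vbar (θ - θ') := by
      have := vbar.map_le_add (hle θ' hθ') (le_refl (vbar (α - θ')))
      rwa [sub_add_sub_cancel] at this
    rw [← hext (θ - θ')] at h2
    have := wbar.map_le_add h1 h2
    rwa [map_sub RatFunc.C, sub_add_sub_cancel] at this
  refine lt_of_le_of_lt ?_ hlt
  rw [hwf] at h0 ⊢
  -- Since `deg f < deg g`, the symmetry gives `v(f(θ)) ≤ v(g(α))` only for nonnegative `v(f(θ))`;
  -- this is where `h0` enters.
  refine WithTop.le_of_nsmul_eq_nsmul hfi.natDegree_pos hdeg.le h0 ?_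
    (natDegree_nsmul_map_aeval hinv hfi hfm hgi hg.monic hα hθ)
  rw [← hwf, w.ne_top_iff]
  simpa using hfm.ne_zero

end KeyPolynomialChains

theorem mainTheorem5 {K Kbar : Type u} {Γ : Type*} [Field K] [Field Kbar] [Algebra K Kbar]
    [IsAlgClosure K Kbar] [AddCommGroup Γ] [LinearOrder Γ] [IsOrderedAddMonoid Γ]
    (v : AddValuation K (WithTop Γ)) (hv : IsHenselianValuation v)
    (vbar : AddValuation Kbar (WithTop Γ)) (hvbar : ∀ a : K, vbar (algebraMap K Kbar a) = v a)
    (w : AddValuation (RatFunc K) (WithTop Γ)) (hw : IsExtensionToRatFunc v w)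
    (wbar : AddValuation (RatFunc Kbar) (WithTop Γ)) (hwbar : IsCommonExtension vbar w wbar)
    (Q : K[X]) (hQ : IsABKP wbar Q)
    (hwQ : ∀ f : K[X], truncation w Q f = w (algebraMap K[X] (RatFunc K) f))
    (r : ℕ) (F : Fin (r + 1) → K[X]) (hF : IsSaturatedDistinguishedChain vbar Q F) :
    IsCompleteSet w wbar F ∧
      (F 0).natDegree = 1 ∧
      (∀ i j, i < j → (F i).natDegree < (F j).natDegree) ∧
      (0 ≤ w (algebraMap K[X] (RatFunc K) (F 0)) → ∀ i j, i < j →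
        w (algebraMap K[X] (RatFunc K) (F i)) < w (algebraMap K[X] (RatFunc K) (F j))) := by
  have : IsAlgClosed Kbar := IsAlgClosure.isAlgClosed K
  have : Algebra.IsAlgebraic K Kbar := IsAlgClosure.isAlgebraic
  have : Normal K Kbar := IsAlgClosure.normal K Kbar
  have hinv := hv.map_algEquiv hvbar
  have habkp : ∀ i, IsABKP wbar (F i) := by
    intro i
    induction i using Fin.reverseInduction with
    | last => rwa [hF.last_eq]
    | cast i ih =>
      exact ih.of_isDistinguishedPolyPair hinv hwbar.extends_vbar (hF.irreducible _)
        (hF.irreducible _) (hF.monic _) (hF.pair i)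
  have hdeg : StrictMono fun i => (F i).natDegree := Fin.strictMono_iff_lt_succ.2 fun i =>
    (hF.pair i).natDegree_lt (hF.irreducible _) (hF.monic _) (hF.irreducible _) (hF.monic _)
  have hδ : StrictMono fun i => optimalValue wbar (F i) := fun i j hij =>
    (habkp j).lt_optimalValue _ (hF.monic i).ne_zero (hdeg hij)
  refine ⟨⟨habkp, fun i j hij => hδ.injective.ne hij, ?_, fun i j => hδ.lt_iff_lt.symm,
    fun f => ⟨Fin.last r, by rw [hF.last_eq]; exact hwQ f⟩⟩, hF.natDegree_zero,
    fun i j hij => hdeg hij, fun h0 => ?_⟩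
  · have : (fun i j => optimalValue wbar (F i) < optimalValue wbar (F j)) =
        ((· < ·) : Fin (r + 1) → Fin (r + 1) → Prop) := by
      ext i j
      exact hδ.lt_iff_lt
    rw [this]
    infer_instance
  · have hstep : ∀ i : Fin r, 0 ≤ w (algebraMap K[X] (RatFunc K) (F i.castSucc)) →
        w (algebraMap K[X] (RatFunc K) (F i.castSucc)) <
          w (algebraMap K[X] (RatFunc K) (F i.succ)) := fun i hi =>
      (habkp i.succ).map_lt_map hinv hwbar (hF.irreducible _) (hF.irreducible _) (hF.monic _)
        (hF.pair i) hi
    -- Each step needs its lower value nonnegative; this propagates up from `F 0`.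
    have hnonneg : ∀ i, 0 ≤ w (algebraMap K[X] (RatFunc K) (F i)) := by
      intro i
      induction i using Fin.inductionOn with
      | zero => exact h0
      | succ i ih => exact ih.trans (hstep i ih).le
    have hmono : StrictMono fun i => w (algebraMap K[X] (RatFunc K) (F i)) :=
      Fin.strictMono_iff_lt_succ.2 fun i => hstep i (hnonneg _)
    exact fun i j hij => hmono hij
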